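/- Let $k\ge 1$ be an integer, let $S^1=\{z\in\mathbb{C}:|z|=1\}$, and let $(S^1)_k$ be the set of formal $k$-barycenters of $S^1$, that is, of all probability measures on $S^1$ of the form $\sigma=\sum_{i=1}^k t_i\delta_{x_i}$ with $x_i\in S^1$ (not necessarily distinct), $t_i\ge 0$ and $\sum_{i=1}^k t_i=1$. Equip $(S^1)_k$ with the Kantorovich–Rubinstein metric $$d_{KR}(\sigma,\tau)=\sup\Big\{\Big|\int_{S^1} f\,d\sigma-\int_{S^1} f\,d\tau\Big| \;:\; f:S^1\to\mathbb{R},\ |f(x)-f(y)|\le |x-y| \text{ for all } x,y\in S^1\Big\},$$ and define $F_k:(S^1)_k\to\mathbb{C}^k$ by $$F_k(\sigma)=\Big(\int_{S^1} z\,d\sigma,\ \int_{S^1} z^2\,d\sigma,\ \dots,\ \int_{S^1} z^k\,d\sigma\Big).$$ Then $F_k$ is a homeomorphism of $(S^1)_k$ onto a set $\mathcal{S}_k\subset\mathbb{C}^k$ that is homeomorphic to the sphere $S^{2k-1}$, and $\mathcal{S}_k$ bounds a neighborhood $\mathcal{U}_k$ of $0$: there is a bounded, connected, open set $\mathcal{U}_k\subset\mathbb{C}^k$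 with $0\in\mathcal{U}_k$ and $\partial\,\mathcal{U}_k=\mathcal{S}_k$. -/

import Mathlib

open MeasureTheory Filter Topology
open scoped NNReal ENNReal

noncomputable section

namespace BaryCircle

/-- The unit circle `S¹ ⊂ ℂ`, with the (chordal) metric and the Borel structure of `ℂ`. -/
abbrev S1 : Type := Metric.sphere (0 : ℂ) 1

/-- The Kantorovich-Rubinstein distance
`sup { |∫ f dμ - ∫ f dν| : f real-valued, Lipschitz with constant at most 1 }`
on measures on `S¹`. For probability measures the set of these values is bounded by `4`. -/
def krDist (μ ν : Measure S1) : ℝ :=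
  ⨆ f : {f : S1 → ℝ // LipschitzWith 1 f}, |∫ x, f.1 x ∂μ - ∫ x, f.1 x ∂ν|

/-- The set of measures `∑ i, t i • δ_{x i}` on `S¹`, with `k` points `x i` (not necessarily
distinct) and weights `t i ≥ 0` of sum `1`. -/
def baryMeasures (k : ℕ) : Set (Measure S1) :=
  {μ | ∃ t ∈ stdSimplex ℝ (Fin k), ∃ x : Fin k → S1,
    μ = ∑ i, ENNReal.ofReal (t i) • Measure.dirac (x i)}

/-- The space `(S¹)_k` of formal `k`-barycenters of `S¹`; a point is a measure, so that
different data `(t, x)` giving the same measure give the same point. -/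
def Barycenter (k : ℕ) : Type := baryMeasures k

/-- The probability measure on `S¹` that a formal barycenter is. -/
def Barycenter.toMeasure {k : ℕ} (σ : Barycenter k) : Measure S1 := σ.1

instance {k : ℕ} (σ : Barycenter k) : IsProbabilityMeasure σ.toMeasure := by
  obtain ⟨μ, t, ⟨ht0, ht1⟩, x, rfl⟩ := σ
  constructor
  simp only [Barycenter.toMeasure, Measure.coe_finsetSum, Finset.sum_apply, Measure.smul_apply,
    measure_univ, smul_eq_mul, mul_one]
  rw [← ENNReal.ofReal_sum_of_nonneg (fun i _ => ht0 i), ht1, ENNReal.ofReal_one]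

theorem integrable_lip (μ : Measure S1) [IsProbabilityMeasure μ] {C : ℝ≥0} {f : S1 → ℝ}
    (hf : LipschitzWith C f) : Integrable f μ :=
  hf.continuous.integrable_of_hasCompactSupport (HasCompactSupport.of_compactSpace f)

theorem abs_integral_sub_le (μ : Measure S1) [IsProbabilityMeasure μ] {f : S1 → ℝ}
    (hf : LipschitzWith 1 f) (p : S1) : |∫ x, f x ∂μ - f p| ≤ 2 := by
  have h : ∫ x, f x ∂μ - f p = ∫ x, (f x - f p) ∂μ := by
    rw [integral_sub (integrable_lip μ hf) (integrable_const _)]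
    simp
  rw [h]
  have h2 : ∀ x, ‖f x - f p‖ ≤ 2 := by
    intro x
    have h3 := hf.dist_le_mul x p
    rw [Real.dist_eq] at h3
    have h4 : dist x p ≤ 2 := by
      have := dist_triangle_right (x : ℂ) (p : ℂ) 0
      rw [mem_sphere_zero_iff_norm.1 x.2 |> (dist_zero_right (x : ℂ)).trans,
        mem_sphere_zero_iff_norm.1 p.2 |> (dist_zero_right (p : ℂ)).trans] at this
      rw [Subtype.dist_eq]
      linarith
    simp only [NNReal.coe_one, one_mul] at h3
    exact h3.trans h4
  simpa using norm_integral_le_of_norm_le_const (μ := μ) (Eventually.of_forall h2)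

theorem krDist_bddAbove (μ ν : Measure S1) [IsProbabilityMeasure μ] [IsProbabilityMeasure ν] :
    BddAbove (Set.range fun f : {f : S1 → ℝ // LipschitzWith 1 f} =>
      |∫ x, f.1 x ∂μ - ∫ x, f.1 x ∂ν|) := by
  refine ⟨4, ?_⟩
  rintro _ ⟨⟨f, hf⟩, rfl⟩
  let p : S1 := ⟨1, by simp⟩
  have h1 := abs_integral_sub_le μ hf p
  have h2 := abs_integral_sub_le ν hf p
  rw [abs_le] at h1 h2 ⊢
  constructor <;> dsimp only <;> linarith [h1.1, h1.2, h2.1, h2.2]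

theorem le_krDist (μ ν : Measure S1) [IsProbabilityMeasure μ] [IsProbabilityMeasure ν]
    {f : S1 → ℝ} (hf : LipschitzWith 1 f) :
    |∫ x, f x ∂μ - ∫ x, f x ∂ν| ≤ krDist μ ν :=
  le_ciSup (krDist_bddAbove μ ν) ⟨f, hf⟩

instance : Nonempty {f : S1 → ℝ // LipschitzWith 1 f} :=
  ⟨⟨fun _ => 0, LipschitzWith.const' 0⟩⟩

theorem krDist_triangle (μ ν ρ : Measure S1) [IsProbabilityMeasure μ] [IsProbabilityMeasure ν]
    [IsProbabilityMeasure ρ] : krDist μ ρ ≤ krDist μ ν + krDist ν ρ :=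
  ciSup_le fun f => (abs_sub_le _ (∫ x, f.1 x ∂ν) _).trans
    (add_le_add (le_krDist μ ν f.2) (le_krDist ν ρ f.2))

theorem eq_of_krDist_eq_zero (μ ν : Measure S1) [IsProbabilityMeasure μ] [IsProbabilityMeasure ν]
    (h : krDist μ ν = 0) : μ = ν := by
  have key : ∀ (C : ℝ≥0) (f : S1 → ℝ), LipschitzWith C f → ∫ x, f x ∂μ = ∫ x, f x ∂ν := by
    intro C f hf
    have hpos : (0 : ℝ) < (C : ℝ) + 1 := by positivity
    have hg : LipschitzWith 1 fun x => ((C : ℝ) + 1)⁻¹ * f x := by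
      refine LipschitzWith.of_dist_le_mul fun x y => ?_
      have h1 := hf.dist_le_mul x y
      rw [Real.dist_eq] at h1 ⊢
      rw [← mul_sub, abs_mul, abs_of_pos (inv_pos.2 hpos), inv_mul_le_iff₀ hpos]
      have h2 : (0 : ℝ) ≤ dist x y := dist_nonneg
      simp only [NNReal.coe_one, one_mul]
      nlinarith
    have h3 := le_krDist μ ν hg
    rw [h, integral_const_mul, integral_const_mul, ← mul_sub] at h3
    have h4 := abs_eq_zero.1 (le_antisymm h3 (abs_nonneg _))
    rcases mul_eq_zero.1 h4 with h5 | h5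
    · exact absurd h5 (inv_pos.2 hpos).ne'
    · linarith
  have hcl : ∀ F : Set S1, IsClosed F → μ F = ν F := by
    intro F hF
    have hp : ∀ n : ℕ, (0 : ℝ) < 1 / ((n : ℝ) + 1) := fun n => Nat.one_div_pos_of_nat
    have hl : Tendsto (fun n : ℕ => 1 / ((n : ℝ) + 1)) atTop (𝓝 0) :=
      tendsto_one_div_add_atTop_nhds_zero_nat
    have h1 := tendsto_integral_thickenedIndicator_of_isClosed μ hF hp hl
    have h2 := tendsto_integral_thickenedIndicator_of_isClosed ν hF hp hl
    have h3 : ∀ n, ∫ x, (thickenedIndicator (hp n) F x : ℝ) ∂μ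
        = ∫ x, (thickenedIndicator (hp n) F x : ℝ) ∂ν := fun n =>
      key _ _ (lipschitzWith_thickenedIndicator (hp n) F)
    simp_rw [h3] at h1
    have h4 := tendsto_nhds_unique h1 h2
    exact (measureReal_eq_measureReal_iff).1 h4
  refine ext_of_generate_finite _ ?_ isPiSystem_isClosed (fun F hF => hcl F hF) (by simp)
  rw [BorelSpace.measurable_eq (α := S1), borel_eq_generateFrom_isClosed]

/-- `(S¹)_k` as a metric space, with the Kantorovich-Rubinstein distance. -/
instance (k : ℕ) : MetricSpace (Barycenter k) where
  dist σ τ := krDist σ.toMeasure τ.toMeasure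
  dist_self σ := by simp [krDist]
  dist_comm σ τ := by simp only [krDist, abs_sub_comm]
  dist_triangle σ τ ρ := krDist_triangle _ _ _
  eq_of_dist_eq_zero {σ τ} h :=
    Subtype.ext (eq_of_krDist_eq_zero σ.toMeasure τ.toMeasure h)

/-- The moment map `F_k(σ) = (∫ z dσ, ∫ z² dσ, …, ∫ z^k dσ) ∈ ℂ^k`. -/
def momentMap (k : ℕ) (σ : Barycenter k) : EuclideanSpace ℂ (Fin k) :=
  WithLp.toLp 2 fun j => ∫ z : S1, (z : ℂ) ^ ((j : ℕ) + 1) ∂σ.toMeasure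

end BaryCircle

end

/-!
Let `γ(z) = (z, z², …, z^k)` be the moment curve and let `K` be the convex hull of `γ(S¹)` in `ℂ^k`,
a compact convex set. The moment map sends `∑ tᵢ δ_{xᵢ}` to `∑ tᵢ γ(xᵢ)`. Following Carathéodory,
its image is exactly the boundary of `K`, and it is injective.

Real-linear functionals on `ℂ^k` restricted to `γ` are the real trigonometric polynomials of degree
at most `k` without constant term, and two facts about these carry the proof.
* A nonconstant one attains its maximum at no more than `k` points, since each such point is a
  double root of a polynomial of degree at most `2k` (`card_le_of_reForm_eq_max`). So a supporting
  hyperplane at a boundary point of `K` touches `γ` in at most `k` points, and the boundary point is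
  a convex combination of these.
* Conversely any `k` points are the maximum points of such a polynomial, since
  `|∏ (z - xᵢ)|²` is a trigonometric polynomial of degree `k` (`exists_reForm_max_iff`). So a
  combination of `k` points of `γ` lies on a supporting hyperplane, hence on the boundary of `K`.
  Also, a second barycenter with the same moments gives mean zero to `|∏ (z - xᵢ)|²`, so it is
  carried by the `xᵢ`, and Lagrange interpolation at these points identifies the weights.

The barycenters form a compact space on which the moment map is continuous, so it is a homeomorphism
onto the boundary of `K`. The origin is interior to `K`, as every small `w` is the moment vector of
a positive trigonometric density on the roots of unity of order `2k + 1`. Hence the boundary of `K` is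
a sphere by radial rescaling, and the interior of `K` is the required domain.
-/

noncomputable section

namespace BaryCircle

open Polynomial ComplexConjugate

/-! ### Trigonometric polynomials as linear functionals on the moment curve -/

/-- The moment curve `z ↦ (z, z², …, z^k)` in `ℂ^k`. -/
def momentCurve (k : ℕ) (z : ℂ) : EuclideanSpace ℂ (Fin k) :=
  WithLp.toLp 2 fun j => z ^ ((j : ℕ) + 1)

/-- The real-linear functional `w ↦ Re ∑ cⱼ wⱼ` on `ℂ^k`. Along the moment curve over the circle it
is a real trigonometric polynomial of degree at most `k` without constant term. -/
def reForm {k : ℕ} (c : Fin k → ℂ) : EuclideanSpace ℂ (Fin k) →ₗ[ℝ] ℝ where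
  toFun w := (∑ j, c j * w j).re
  map_add' v w := by simp [mul_add, Finset.sum_add_distrib]
  map_smul' r w := by simp [Finset.mul_sum, mul_sub]; congr! 2 <;> ring

theorem reForm_apply {k : ℕ} (c : Fin k → ℂ) (w : EuclideanSpace ℂ (Fin k)) :
    reForm c w = (∑ j, c j * w j).re := rfl

theorem reForm_momentCurve {k : ℕ} (c : Fin k → ℂ) (z : ℂ) :
    reForm c (momentCurve k z) = (∑ j, c j * z ^ ((j : ℕ) + 1)).re := rfl

/-- The polynomial of degree at most `2k` which on the unit circle is `z^k` times the
trigonometric polynomial `2 (M - Re ∑ cⱼ z^(j+1))`. -/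
def trigNumerator {k : ℕ} (c : Fin k → ℂ) (M : ℝ) : ℂ[X] :=
  C (2 * M : ℂ) * X ^ k - ∑ j : Fin k, C (c j) * X ^ (k + (j + 1))
    - ∑ j : Fin k, C (conj (c j)) * X ^ (k - (j + 1))

theorem eval_trigNumerator {k : ℕ} (c : Fin k → ℂ) (M : ℝ) {z : ℂ} (hz : ‖z‖ = 1) :
    (trigNumerator c M).eval z
      = z ^ k * ((2 * (M - reForm c (momentCurve k z)) : ℝ) : ℂ) := by
  have hzz : z * conj z = 1 := by rw [Complex.mul_conj, Complex.normSq_eq_norm_sq, hz]; simp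
  have hre : ((reForm c (momentCurve k z) : ℝ) : ℂ)
      = (∑ j, c j * z ^ ((j : ℕ) + 1) + ∑ j, conj (c j) * conj z ^ ((j : ℕ) + 1)) / 2 := by
    rw [reForm_momentCurve, Complex.re_eq_add_conj, map_sum]
    simp
  have hpow : ∀ j : Fin k, z ^ (k - ((j : ℕ) + 1)) = z ^ k * conj z ^ ((j : ℕ) + 1) := by
    intro j
    have h : z ^ k = z ^ (k - ((j : ℕ) + 1)) * z ^ ((j : ℕ) + 1) := by
      rw [← pow_add]; congr 1; omega
    rw [h, mul_assoc, ← mul_pow, hzz, one_pow, mul_one]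
  push_cast
  rw [hre]
  simp only [trigNumerator, eval_sub, eval_mul, eval_C, eval_pow, eval_X, eval_finsetSum, hpow]
  have h1 : ∑ j : Fin k, c j * z ^ (k + ((j : ℕ) + 1))
      = z ^ k * ∑ j : Fin k, c j * z ^ ((j : ℕ) + 1) := by
    rw [Finset.mul_sum]; exact Finset.sum_congr rfl fun j _ => by ring
  have h2 : ∑ j : Fin k, conj (c j) * (z ^ k * conj z ^ ((j : ℕ) + 1))
      = z ^ k * ∑ j : Fin k, conj (c j) * conj z ^ ((j : ℕ) + 1) := by
    rw [Finset.mul_sum]; exact Finset.sum_congr rfl fun j _ => by ring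
  rw [h1, h2]
  ring

theorem natDegree_trigNumerator_le {k : ℕ} (c : Fin k → ℂ) (M : ℝ) :
    (trigNumerator c M).natDegree ≤ 2 * k := by
  refine (natDegree_sub_le _ _).trans
    (max_le ((natDegree_sub_le _ _).trans (max_le ?_ ?_)) ?_)
  · exact (natDegree_C_mul_X_pow_le _ _).trans (by omega)
  · exact natDegree_sum_le_of_forall_le _ _ fun j _ =>
      (natDegree_C_mul_X_pow_le _ _).trans (by omega)
  · exact natDegree_sum_le_of_forall_le _ _ fun j _ =>
      (natDegree_C_mul_X_pow_le _ _).trans (by omega)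

theorem trigNumerator_ne_zero {k : ℕ} {c : Fin k → ℂ} (hc : c ≠ 0) (M : ℝ) :
    trigNumerator c M ≠ 0 := by
  obtain ⟨i, hi⟩ := Function.ne_iff.1 hc
  intro h
  have h1 := congrArg (fun p : ℂ[X] => p.coeff (k + (i + 1))) h
  have h2 : ∀ j : Fin k, k + ((i : ℕ) + 1) ≠ k - ((j : ℕ) + 1) := fun j => by omega
  have h3 : ∀ j : Fin k, k + ((i : ℕ) + 1) = k + ((j : ℕ) + 1) ↔ i = j := fun j => by
    rw [Fin.ext_iff]; omega
  simp only [trigNumerator, coeff_sub, finsetSum_coeff, coeff_C_mul, coeff_X_pow, h2, h3] at h1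
  simp at h1
  exact hi h1

/-- A zero on the circle of a nonnegative trigonometric polynomial is a minimum, hence a double
zero. -/
theorem one_lt_rootMultiplicity_trigNumerator {k : ℕ} {c : Fin k → ℂ} (hc : c ≠ 0) {M : ℝ}
    (hM : ∀ z : ℂ, ‖z‖ = 1 → reForm c (momentCurve k z) ≤ M) {z : ℂ} (hz : ‖z‖ = 1)
    (hzM : reForm c (momentCurve k z) = M) :
    1 < (trigNumerator c M).rootMultiplicity z := by
  have hroot : (trigNumerator c M).eval z = 0 := by
    rw [eval_trigNumerator c M hz, hzM]; simp
  rw [one_lt_rootMultiplicity_iff_isRoot (trigNumerator_ne_zero hc M)]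
  refine ⟨hroot, ?_⟩
  obtain ⟨θ, rfl⟩ : ∃ θ : ℝ, Complex.exp (θ * Complex.I) = z := by
    rwa [← Complex.norm_eq_one_iff]
  let h : ℝ → ℝ := fun t => 2 * (M - reForm c (momentCurve k (Complex.exp (t * Complex.I))))
  have hexp : ∀ t : ℝ, HasDerivAt (fun t : ℝ => Complex.exp (t * Complex.I))
      (Complex.exp (t * Complex.I) * Complex.I) t := by
    intro t
    have h1 := ((hasDerivAt_id t).ofReal_comp.mul_const Complex.I).cexp
    simpa using h1
  have hdiff : DifferentiableAt ℝ h θ := by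
    have h1 : DifferentiableAt ℝ (fun t : ℝ =>
        ∑ j : Fin k, c j * Complex.exp (t * Complex.I) ^ ((j : ℕ) + 1)) θ :=
      DifferentiableAt.fun_sum fun j _ => ((hexp θ).differentiableAt.pow _).const_mul _
    have h2 : DifferentiableAt ℝ (fun t : ℝ =>
        (∑ j : Fin k, c j * Complex.exp (t * Complex.I) ^ ((j : ℕ) + 1)).re) θ :=
      Complex.reCLM.differentiableAt.comp θ h1
    exact (h2.const_sub M).const_mul 2
  have hmin : IsLocalMin h θ := by
    refine Eventually.of_forall fun t => ?_
    have h1 := hM _ (Complex.norm_exp_ofReal_mul_I t)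
    simp only [h, hzM]
    linarith
  have hder : HasDerivAt h 0 θ := hmin.deriv_eq_zero ▸ hdiff.hasDerivAt
  have hl := ((trigNumerator c M).hasDerivAt (Complex.exp (θ * Complex.I))).comp θ (hexp θ)
  have hr := ((hexp θ).pow k).mul hder.ofReal_comp
  have heq : (fun t : ℝ => (trigNumerator c M).eval (Complex.exp (t * Complex.I)))
      = (fun t : ℝ => Complex.exp (t * Complex.I)) ^ k * fun t => ((h t : ℝ) : ℂ) := by
    funext t
    exact eval_trigNumerator c M (Complex.norm_exp_ofReal_mul_I t)
  have h0 : h θ = 0 := by simp [h, hzM]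
  have := hl.unique (heq ▸ hr)
  simpa [h0] using this

/-- A nonconstant real trigonometric polynomial of degree at most `k` attains its maximum at no
more than `k` points of the circle: each is a double root of a polynomial of degree at most `2k`. -/
theorem card_le_of_reForm_eq_max {k : ℕ} {c : Fin k → ℂ} (hc : c ≠ 0) {M : ℝ}
    (hM : ∀ z : ℂ, ‖z‖ = 1 → reForm c (momentCurve k z) ≤ M) (Z : Finset ℂ)
    (hZ : ∀ z ∈ Z, ‖z‖ = 1 ∧ reForm c (momentCurve k z) = M) : Z.card ≤ k := by
  have hle : 2 • Z.val ≤ (trigNumerator c M).roots := by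
    rw [Multiset.le_iff_count]
    intro z
    rw [Multiset.count_nsmul, count_roots]
    by_cases hz : z ∈ Z
    · rw [Multiset.count_eq_one_of_mem Z.nodup hz]
      exact one_lt_rootMultiplicity_trigNumerator hc hM (hZ z hz).1 (hZ z hz).2
    · rw [Multiset.count_eq_zero_of_notMem hz]; simp
  have h1 := Multiset.card_le_card hle
  simp only [Multiset.card_nsmul, Finset.card_val] at h1
  have h2 := (card_roots' (trigNumerator c M)).trans (natDegree_trigNumerator_le c M)
  omega

/-! ### Roots of unity and prescribed maximum points -/

/-- The `N`-th roots of unity, as points of the circle. -/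
def rootPoint (N : ℕ) [NeZero N] (m : Fin N) : S1 :=
  ⟨Complex.exp (2 * Real.pi * Complex.I / N) ^ (m : ℕ), by
    have h := (Complex.isPrimitiveRoot_exp N (NeZero.ne N)).norm'_eq_one (NeZero.ne N)
    rw [mem_sphere_zero_iff_norm, norm_pow, h, one_pow]⟩

theorem rootPoint_injective (N : ℕ) [NeZero N] : Function.Injective (rootPoint N) := by
  intro a b hab
  exact Fin.ext ((Complex.isPrimitiveRoot_exp N (NeZero.ne N)).pow_inj a.2 b.2
    (congrArg Subtype.val hab))

/-- Any `k` points of the circle are the maximum points of a nonconstant real trigonometric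
polynomial of degree `k`, namely of a constant minus `|∏ (z - xᵢ)|²`. -/
theorem exists_reForm_max_iff {k : ℕ} (hk : 1 ≤ k) (x : Fin k → S1) :
    ∃ (c : Fin k → ℂ) (M : ℝ), c ≠ 0 ∧ ∀ z : S1, reForm c (momentCurve k z) ≤ M ∧
      (reForm c (momentCurve k z) = M ↔ z ∈ Set.range x) := by
  have hx : ∀ z : S1, (z : ℂ) * conj (z : ℂ) = 1 := fun z => by
    rw [Complex.mul_conj, Complex.normSq_eq_norm_sq, mem_sphere_zero_iff_norm.1 z.2]; simp
  let p : ℂ[X] := ∏ i, (X - C (x i : ℂ))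
  let u : ℂ := ∏ i, -conj (x i : ℂ)
  let Q : ℂ[X] := C u * p ^ 2
  have hp : ∀ z : ℂ, p.eval z = ∏ i, (z - x i) := fun z => by simp [p, eval_prod]
  have hpdeg : p.natDegree = k := by
    simp [p, natDegree_prod_of_monic _ _ fun i _ => monic_X_sub_C (x i : ℂ)]
  have hQdeg : Q.natDegree < k + (k + 1) := by
    have h1 : Q.natDegree ≤ (p ^ 2).natDegree := natDegree_C_mul_le _ _
    rw [natDegree_pow, hpdeg] at h1
    omega
  -- On the circle `conj p(z) = z^(-k) u p(z)`, so `|p(z)|² = z^(-k) Q(z)`.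
  have hnorm : ∀ z : S1, ((‖p.eval (z : ℂ)‖ ^ 2 : ℝ) : ℂ) = conj (z : ℂ) ^ k * Q.eval (z : ℂ) := by
    intro z
    have h1 : ((‖p.eval (z : ℂ)‖ ^ 2 : ℝ) : ℂ) = p.eval (z : ℂ) * conj (p.eval (z : ℂ)) := by
      rw [Complex.mul_conj, Complex.normSq_eq_norm_sq]
    have h2 : conj (p.eval (z : ℂ)) = conj (z : ℂ) ^ k * (u * p.eval (z : ℂ)) := by
      rw [hp, map_prod, ← Finset.prod_mul_distrib, ← Fin.prod_const, ← Finset.prod_mul_distrib]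
      refine Finset.prod_congr rfl fun i _ => ?_
      rw [map_sub]
      linear_combination (-conj (x i : ℂ)) * (hx z) * (-1) - conj (z : ℂ) * hx (x i)
    rw [h1, h2]
    simp only [Q, eval_mul, eval_C, eval_pow]
    ring
  let c : Fin k → ℂ := fun j => -(Q.coeff (k + (j + 1)) + conj (Q.coeff (k - (j + 1))))
  have hexp : ∀ z : S1, ‖p.eval (z : ℂ)‖ ^ 2 = (Q.coeff k).re - reForm c (momentCurve k z) := by
    intro z
    have hz : ∀ a b : ℕ, conj (z : ℂ) ^ a * (z : ℂ) ^ (a + b) = (z : ℂ) ^ b := by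
      intro a b
      rw [pow_add, ← mul_assoc, ← mul_pow, mul_comm (conj _), hx, one_pow, one_mul]
    -- Split `Q` at degree `k`; the terms below the middle one are conjugated onto those above.
    have h1 := congrArg Complex.re (hnorm z)
    rw [Complex.ofReal_re, eval_eq_sum_range' hQdeg, Finset.mul_sum, Finset.sum_range_add,
      Finset.sum_range_succ', ← Finset.sum_range_reflect, Finset.sum_range, Finset.sum_range] at h1
    rw [h1, reForm_momentCurve, Complex.add_re, Complex.add_re, ← Complex.conj_re (∑ j : Fin k, _),
      map_sum]
    have h2 : ∀ j : Fin k, conj (conj (z : ℂ) ^ k * (Q.coeff (k - 1 - j) * (z : ℂ) ^ (k - 1 - j)))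
        = conj (Q.coeff (k - (j + 1))) * (z : ℂ) ^ ((j : ℕ) + 1) := by
      intro j
      have h3 : k - 1 - (j : ℕ) = k - (j + 1) := by omega
      have h4 := congrArg conj (hz (k - (j + 1)) 0)
      have h5 : k = (k - ((j : ℕ) + 1)) + (j + 1) := by omega
      rw [h3]
      nth_rewrite 1 [h5]
      simp only [map_mul, map_pow, Complex.conj_conj] at h4 ⊢
      simp only [add_zero, pow_zero] at h4
      linear_combination (z : ℂ) ^ ((j : ℕ) + 1) * conj (Q.coeff (k - (j + 1))) * h4
    have h6 : ∀ j : Fin k,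
        conj (z : ℂ) ^ k * (Q.coeff (k + (j + 1)) * (z : ℂ) ^ (k + ((j : ℕ) + 1)))
          = Q.coeff (k + (j + 1)) * (z : ℂ) ^ ((j : ℕ) + 1) := by
      intro j
      linear_combination Q.coeff (k + (j + 1)) * hz k (j + 1)
    have h7 : conj (z : ℂ) ^ k * (Q.coeff (k + 0) * (z : ℂ) ^ (k + 0)) = Q.coeff k := by
      have := hz k 0
      simp only [add_zero, pow_zero] at this ⊢
      linear_combination Q.coeff k * this
    simp only [h2, h6, h7]
    simp only [c, neg_mul, add_mul, Finset.sum_neg_distrib, Finset.sum_add_distrib, Complex.neg_re,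
      Complex.add_re]
    ring
  have hiff : ∀ z : S1, reForm c (momentCurve k z) = (Q.coeff k).re ↔ z ∈ Set.range x := by
    intro z
    have h1 : reForm c (momentCurve k z) = (Q.coeff k).re ↔ ‖p.eval (z : ℂ)‖ ^ 2 = 0 := by
      rw [hexp z]; constructor <;> intro h <;> linarith
    rw [h1, sq_eq_zero_iff, norm_eq_zero, hp, Finset.prod_eq_zero_iff]
    simp only [Finset.mem_univ, true_and, sub_eq_zero, Set.mem_range]
    exact exists_congr fun i => ⟨fun h => Subtype.ext h.symm, fun h => h ▸ rfl⟩
  refine ⟨c, (Q.coeff k).re, ?_, fun z => ⟨?_, hiff z⟩⟩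
  · intro hc
    -- If `c = 0`, the form is constant, so the `k + 1` roots of unity are among the `k` points `xᵢ`.
    have hM : 0 = (Q.coeff k).re := by
      simpa [hc, reForm_apply] using (hiff (x ⟨0, hk⟩)).2 ⟨_, rfl⟩
    have huniv : Set.range x = Set.univ := Set.eq_univ_of_forall fun z =>
      (hiff z).1 (by simpa [hc, reForm_apply] using hM)
    have hsurj : Function.Surjective x := Set.range_eq_univ.1 huniv
    have h1 := Fintype.card_le_of_injective _
      ((Function.injective_surjInv hsurj).comp (rootPoint_injective (k + 1)))
    simp at h1
  · have := hexp z
    nlinarith [sq_nonneg ‖p.eval (z : ℂ)‖]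

theorem sum_rootPoint_pow (N : ℕ) [NeZero N] (e : ℕ) :
    ∑ m, (rootPoint N m : ℂ) ^ e = if N ∣ e then (N : ℂ) else 0 := by
  have hζ := Complex.isPrimitiveRoot_exp N (NeZero.ne N)
  set ζ := Complex.exp (2 * Real.pi * Complex.I / N) with hζdef
  have h1 : ∀ m : Fin N, (rootPoint N m : ℂ) ^ e = (ζ ^ e) ^ (m : ℕ) := fun m => by
    rw [← pow_mul, mul_comm, pow_mul]; rfl
  simp only [h1]
  rw [Fin.sum_univ_eq_sum_range (fun m => (ζ ^ e) ^ m) N]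
  split_ifs with h
  · rw [(hζ.pow_eq_one_iff_dvd e).2 h]; simp
  · have h2 : ζ ^ e ≠ 1 := fun h3 => h ((hζ.pow_eq_one_iff_dvd e).1 h3)
    rw [geom_sum_eq h2, ← pow_mul, mul_comm e, pow_mul, hζ.pow_eq_one, one_pow, sub_self, zero_div]

theorem rootPoint_pow_card (N : ℕ) [NeZero N] (m : Fin N) : (rootPoint N m : ℂ) ^ N = 1 := by
  have hζ := Complex.isPrimitiveRoot_exp N (NeZero.ne N)
  change (Complex.exp (2 * Real.pi * Complex.I / N) ^ (m : ℕ)) ^ N = 1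
  rw [pow_right_comm, hζ.pow_eq_one, one_pow]

/-! ### The convex hull of the moment curve -/

/-- The convex hull of the moment curve over the circle: the set of first `k` moments of
probability measures on the circle. -/
def momentBody (k : ℕ) : Set (EuclideanSpace ℂ (Fin k)) :=
  convexHull ℝ (Set.range fun z : S1 => momentCurve k z)

theorem convex_momentBody (k : ℕ) : Convex ℝ (momentBody k) := convex_convexHull _ _

theorem sum_smul_mem_momentBody {k : ℕ} {ι : Type*} [Fintype ι] {t : ι → ℝ}
    (ht : t ∈ stdSimplex ℝ ι) (x : ι → S1) :
    ∑ i, t i • momentCurve k (x i) ∈ momentBody k :=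
  (convex_momentBody k).sum_mem (fun i _ => ht.1 i) ht.2
    fun i _ => subset_convexHull ℝ _ ⟨x i, rfl⟩

/-- If `∑ ‖wⱼ‖` is small, then `w` is the moment vector of the measure on the roots of unity of
order `2k + 1` whose density is the positive trigonometric polynomial `1 + 2 Re ∑ wⱼ z^(-j-1)`. -/
theorem mem_momentBody_of_sum_norm_le {k : ℕ} (w : EuclideanSpace ℂ (Fin k))
    (hw : ∑ j, ‖w j‖ ≤ 1 / 2) : w ∈ momentBody k := by
  let N := 2 * k + 1
  have hN : (N : ℂ) ≠ 0 := Nat.cast_ne_zero.2 (by omega)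
  let ω : Fin N → S1 := rootPoint N
  have hω : ∀ m, ‖(ω m : ℂ)‖ = 1 := fun m => mem_sphere_zero_iff_norm.1 (ω m).2
  let t : Fin N → ℝ := fun m =>
    (N : ℝ)⁻¹ * (1 + 2 * (∑ j, w j * conj (ω m : ℂ) ^ ((j : ℕ) + 1)).re)
  have hconj : ∀ m, ∀ e ≤ N, conj (ω m : ℂ) ^ e = (ω m : ℂ) ^ (N - e) := by
    intro m e he
    have h1 : (ω m : ℂ) * conj (ω m : ℂ) = 1 := by
      rw [Complex.mul_conj, Complex.normSq_eq_norm_sq, hω]; simp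
    have h2 : (ω m : ℂ) ^ (N - e) * (ω m : ℂ) ^ e = 1 := by
      rw [← pow_add, Nat.sub_add_cancel he]; exact rootPoint_pow_card N m
    have h3 : (ω m : ℂ) ^ e * conj (ω m : ℂ) ^ e = 1 := by rw [← mul_pow, h1, one_pow]
    linear_combination (-conj (ω m : ℂ) ^ e) * h2 + (ω m : ℂ) ^ (N - e) * h3
  have ht : ∀ m, (t m : ℂ) = (N : ℂ)⁻¹ * (1 + (∑ j : Fin k, w j * (ω m : ℂ) ^ (N - ((j : ℕ) + 1))
      + ∑ j : Fin k, conj (w j) * (ω m : ℂ) ^ ((j : ℕ) + 1))) := by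
    intro m
    have h1 : ∀ j : Fin k, conj (ω m : ℂ) ^ ((j : ℕ) + 1) = (ω m : ℂ) ^ (N - ((j : ℕ) + 1)) :=
      fun j => hconj m _ (by omega)
    simp only [t]
    push_cast
    rw [Complex.re_eq_add_conj, map_sum]
    simp only [map_mul, map_pow, Complex.conj_conj]
    simp only [h1]
    ring
  have hmom : ∀ e, ∑ m, (t m : ℂ) * (ω m : ℂ) ^ e = (N : ℂ)⁻¹ * ((if N ∣ e then (N : ℂ) else 0)
      + (∑ j : Fin k, w j * (if N ∣ N - ((j : ℕ) + 1) + e then (N : ℂ) else 0)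
      + ∑ j : Fin k, conj (w j) * (if N ∣ (j : ℕ) + 1 + e then (N : ℂ) else 0))) := by
    intro e
    simp only [← sum_rootPoint_pow N, ht, Finset.mul_sum]
    rw [Finset.sum_comm (s := Finset.univ (α := Fin k)),
      Finset.sum_comm (s := Finset.univ (α := Fin k)),
      ← Finset.sum_add_distrib, ← Finset.sum_add_distrib, Finset.mul_sum]
    refine Finset.sum_congr rfl fun m _ => ?_
    rw [mul_assoc, add_mul, add_mul, Finset.sum_mul, Finset.sum_mul, one_mul]
    simp only [pow_add, ω, mul_assoc]
  have htsum : ∑ m, t m = 1 := by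
    have h1 : ∀ j : Fin k, ¬ N ∣ N - ((j : ℕ) + 1) := fun j =>
      Nat.not_dvd_of_pos_of_lt (by omega) (by omega)
    have h2 : ∀ j : Fin k, ¬ N ∣ (j : ℕ) + 1 := fun j =>
      Nat.not_dvd_of_pos_of_lt (by omega) (by omega)
    have h3 := hmom 0
    simp only [pow_zero, mul_one, dvd_zero, if_true, add_zero, h1, h2, if_false, mul_zero,
      Finset.sum_const_zero, inv_mul_cancel₀ hN] at h3
    exact_mod_cast h3
  have htmom : ∀ l : Fin k, ∑ m, (t m : ℂ) * (ω m : ℂ) ^ ((l : ℕ) + 1) = w l := by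
    intro l
    have h1 : ∀ j : Fin k, N ∣ N - ((j : ℕ) + 1) + ((l : ℕ) + 1) ↔ l = j := by
      intro j
      rw [Fin.ext_iff]
      constructor
      · rintro ⟨q, hq⟩
        have h2 : q < 2 := by
          by_contra! h
          have := Nat.mul_le_mul_left N h
          omega
        interval_cases q <;> omega
      · intro h
        exact ⟨1, by omega⟩
    have h2 : ∀ j : Fin k, ¬ N ∣ (j : ℕ) + 1 + ((l : ℕ) + 1) := fun j =>
      Nat.not_dvd_of_pos_of_lt (by omega) (by omega)
    have h3 : ¬ N ∣ (l : ℕ) + 1 := Nat.not_dvd_of_pos_of_lt (by omega) (by omega)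
    rw [hmom]
    simp only [h1, h2, h3, if_false, mul_zero, Finset.sum_const_zero, add_zero, zero_add,
      mul_ite, Finset.sum_ite_eq, Finset.mem_univ, if_true]
    rw [mul_comm (w l), inv_mul_cancel_left₀ hN]
  have htnonneg : ∀ m, 0 ≤ t m := by
    intro m
    have h1 : ‖∑ j, w j * conj (ω m : ℂ) ^ ((j : ℕ) + 1)‖ ≤ 1 / 2 := by
      refine (norm_sum_le _ _).trans (le_of_eq_of_le ?_ hw)
      refine Finset.sum_congr rfl fun j _ => ?_
      rw [norm_mul, norm_pow, RCLike.norm_conj, hω, one_pow, mul_one]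
    have h2 := (abs_le.1 ((Complex.abs_re_le_norm _).trans h1)).1
    have h3 : (0 : ℝ) ≤ (N : ℝ)⁻¹ := by positivity
    exact mul_nonneg h3 (by linarith)
  have hfin : ∑ m, t m • momentCurve k (ω m) = w := by
    ext l
    rw [← htmom l]
    simp [momentCurve]
  exact hfin ▸ sum_smul_mem_momentBody ⟨htnonneg, htsum⟩ ω

theorem zero_mem_interior_momentBody (k : ℕ) :
    (0 : EuclideanSpace ℂ (Fin k)) ∈ interior (momentBody k) := by
  refine mem_interior.2 ⟨{w | ∑ j, ‖w j‖ < 1 / 2},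
    fun w hw => mem_momentBody_of_sum_norm_le w (le_of_lt hw),
    isOpen_lt (by fun_prop) continuous_const, ?_⟩
  simp

theorem continuous_momentCurve (k : ℕ) : Continuous (momentCurve k) := by
  unfold momentCurve
  fun_prop

/-- A convex combination of at most `n` points of the moment curve is one of exactly `n` points. -/
theorem exists_fin_sum_eq {k n : ℕ} {ι : Type*} [Fintype ι] (hn : Fintype.card ι ≤ n) {w : ι → ℝ}
    (hw : w ∈ stdSimplex ℝ ι) (y : ι → S1) :
    ∃ t ∈ stdSimplex ℝ (Fin n), ∃ x : Fin n → S1,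
      ∑ i, t i • momentCurve k (x i) = ∑ i, w i • momentCurve k (y i) := by
  obtain ⟨e⟩ : Nonempty (ι ↪ Fin n) := Function.Embedding.nonempty_of_card_le (by simpa using hn)
  have hout : ∀ i ∉ Set.range e, Function.extend e w 0 i = 0 := fun i hi =>
    Function.extend_apply' _ _ _ hi
  refine ⟨Function.extend e w 0, ⟨fun i => ?_, ?_⟩, Function.extend e y fun _ => rootPoint 1 0, ?_⟩
  · by_cases hi : i ∈ Set.range e
    · obtain ⟨j, rfl⟩ := hi
      rw [e.injective.extend_apply]
      exact hw.1 j
    · rw [hout i hi]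
  · rw [← hw.2]
    exact (Fintype.sum_of_injective e e.injective _ _ hout fun i => by
      rw [e.injective.extend_apply]).symm
  · refine (Fintype.sum_of_injective e e.injective _ _ (fun i hi => ?_) fun i => ?_).symm
    · rw [hout i hi, zero_smul]
    · rw [e.injective.extend_apply, e.injective.extend_apply]

/-- By Carathéodory's theorem the moment body is a continuous image of a compact space. -/
theorem isCompact_momentBody (k : ℕ) : IsCompact (momentBody k) := by
  let n := Module.finrank ℝ (EuclideanSpace ℂ (Fin k)) + 1
  let Φ : stdSimplex ℝ (Fin n) × (Fin n → S1) → EuclideanSpace ℂ (Fin k) := fun q =>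
    ∑ i, q.1.1 i • momentCurve k (q.2 i)
  have hΦ : Continuous Φ := by
    have h1 : ∀ i, Continuous fun q : stdSimplex ℝ (Fin n) × (Fin n → S1) =>
        momentCurve k (q.2 i) := fun i => (continuous_momentCurve k).comp (by fun_prop)
    have h2 : ∀ i, Continuous fun q : stdSimplex ℝ (Fin n) × (Fin n → S1) => q.1.1 i :=
      fun i => (continuous_apply i).comp (continuous_subtype_val.comp continuous_fst)
    exact continuous_finsetSum _ fun i _ => (h2 i).smul (h1 i)
  have hrange : momentBody k = Set.range Φ := by
    refine Set.Subset.antisymm (fun p hp => ?_) ?_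
    · obtain ⟨ι, _, z, w, hz, hind, hw, hw1, rfl⟩ := eq_pos_convex_span_of_mem_convexHull hp
      choose y hy using fun i => hz (Set.mem_range_self i)
      obtain ⟨t, ht, x, hx⟩ := exists_fin_sum_eq (k := k) (n := n)
        ((hind.card_le_finrank_succ).trans (Nat.succ_le_succ (Submodule.finrank_le _)))
        (w := w) ⟨fun i => (hw i).le, hw1⟩ y
      exact ⟨(⟨t, ht⟩, x), hx.trans (Finset.sum_congr rfl fun i _ => by rw [← hy i])⟩
    · rintro _ ⟨⟨t, x⟩, rfl⟩
      exact sum_smul_mem_momentBody t.2 x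
  rw [hrange]
  exact isCompact_range hΦ

theorem reForm_le_of_mem_momentBody {k : ℕ} {c : Fin k → ℂ} {M : ℝ}
    (hM : ∀ z : S1, reForm c (momentCurve k z) ≤ M) {p : EuclideanSpace ℂ (Fin k)}
    (hp : p ∈ momentBody k) : reForm c p ≤ M := by
  have h1 : momentBody k ⊆ {p | reForm c p ≤ M} :=
    convexHull_min (by rintro _ ⟨z, rfl⟩; exact hM z) (convex_halfSpace_le (reForm c).isLinear M)
  exact h1 hp

theorem notMem_interior_of_reForm_eq_max {k : ℕ} {c : Fin k → ℂ} (hc : c ≠ 0) {M : ℝ}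
    (hM : ∀ z : S1, reForm c (momentCurve k z) ≤ M) {p : EuclideanSpace ℂ (Fin k)}
    (hp : reForm c p = M) : p ∉ interior (momentBody k) := by
  intro hint
  let v : EuclideanSpace ℂ (Fin k) := WithLp.toLp 2 fun j => conj (c j)
  have hv : 0 < reForm c v := by
    obtain ⟨i, hi⟩ := Function.ne_iff.1 hc
    have h1 : reForm c v = ∑ j, ‖c j‖ ^ 2 := by
      rw [reForm_apply, Complex.re_sum]
      refine Finset.sum_congr rfl fun j _ => ?_
      change (c j * conj (c j)).re = _
      rw [Complex.mul_conj, Complex.ofReal_re, Complex.normSq_eq_norm_sq]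
    rw [h1]
    exact Finset.sum_pos' (fun j _ => by positivity)
      ⟨i, Finset.mem_univ _, by have := norm_pos_iff.2 hi; positivity⟩
  have hcont : ContinuousAt (fun ε : ℝ => p + ε • v) 0 := by fun_prop
  have hev : ∀ᶠ ε : ℝ in 𝓝[>] 0, p + ε • v ∈ momentBody k := by
    refine (hcont.eventually ?_).filter_mono nhdsWithin_le_nhds
    simpa using mem_interior_iff_mem_nhds.1 hint
  obtain ⟨ε, hε, hε0⟩ := (hev.and self_mem_nhdsWithin).exists
  have h1 := reForm_le_of_mem_momentBody hM hε
  rw [map_add, map_smul, hp, smul_eq_mul] at h1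
  have h2 := mul_pos (Set.mem_Ioi.1 hε0) hv
  linarith

/-- The supporting hyperplane at a boundary point of the moment body. -/
theorem exists_reForm_le_of_mem_frontier {k : ℕ} {p : EuclideanSpace ℂ (Fin k)}
    (hp : p ∈ frontier (momentBody k)) :
    ∃ c : Fin k → ℂ, c ≠ 0 ∧ ∀ q ∈ momentBody k, reForm c q ≤ reForm c p := by
  obtain ⟨f, hf⟩ := RCLike.geometric_hahn_banach_open_point (𝕜 := ℂ)
    (convex_momentBody k).interior isOpen_interior hp.2
  let c : Fin k → ℂ := fun j => f (EuclideanSpace.single j 1)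
  have hfc : ∀ w, RCLike.re (f w) = reForm c w := by
    intro w
    have h1 : w = ∑ j, w j • EuclideanSpace.single j (1 : ℂ) := by
      ext l
      simp [Pi.single_apply]
    conv_lhs => rw [h1]
    rw [map_sum, reForm_apply]
    simp [c, mul_comm]
  simp only [hfc] at hf
  refine ⟨c, ?_, fun q hq => ?_⟩
  · intro hc
    simpa [hc, reForm_apply] using hf 0 (zero_mem_interior_momentBody k)
  · have hq' : q ∈ closure (interior (momentBody k)) := by
      rw [(convex_momentBody k).closure_interior_eq_closure_of_nonempty_interior
        ⟨0, zero_mem_interior_momentBody k⟩]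
      exact subset_closure hq
    have hcl : IsClosed {q | reForm c q ≤ reForm c p} :=
      isClosed_le (reForm c).continuous_of_finiteDimensional continuous_const
    exact closure_minimal (fun a ha => (hf a ha).le) hcl hq'

/-- The boundary of the moment body consists of the convex combinations of `k` points of the
moment curve: a supporting hyperplane touches the curve in at most `k` points, and any `k` points
of the curve lie on a supporting hyperplane. -/
theorem mem_frontier_momentBody_iff {k : ℕ} (hk : 1 ≤ k) (p : EuclideanSpace ℂ (Fin k)) :
    p ∈ frontier (momentBody k) ↔
      ∃ t ∈ stdSimplex ℝ (Fin k), ∃ x : Fin k → S1, ∑ i, t i • momentCurve k (x i) = p := by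
  constructor
  · intro hp
    obtain ⟨c, hc, hmax⟩ := exists_reForm_le_of_mem_frontier hp
    have hpK : p ∈ momentBody k := (isCompact_momentBody k).isClosed.frontier_subset hp
    obtain ⟨ι, _, z, w, hz, hind, hw, hw1, hsum⟩ := eq_pos_convex_span_of_mem_convexHull hpK
    choose y hy using fun i => hz (Set.mem_range_self i)
    have hzmax : ∀ i, reForm c (z i) ≤ reForm c p := fun i =>
      hmax _ (subset_convexHull ℝ _ (hz (Set.mem_range_self i)))
    have hzero : ∑ i, w i * (reForm c p - reForm c (z i)) = 0 := by
      simp only [mul_sub, Finset.sum_sub_distrib]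
      rw [← Finset.sum_mul, hw1, one_mul, sub_eq_zero]
      conv_lhs => rw [← hsum]
      simp
    have hall := (Finset.sum_eq_zero_iff_of_nonneg fun i _ =>
      mul_nonneg (hw i).le (sub_nonneg.2 (hzmax i))).1 hzero
    have heq : ∀ i, reForm c (z i) = reForm c p := fun i => by
      rcases mul_eq_zero.1 (hall i (Finset.mem_univ i)) with h | h
      · exact absurd h (hw i).ne'
      · linarith
    have hyinj : Function.Injective fun i => (y i : ℂ) := fun i j hij =>
      hind.injective (by rw [← hy i, ← hy j]; exact congrArg (momentCurve k) hij)
    have hcard : Fintype.card ι ≤ k := by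
      have h1 := card_le_of_reForm_eq_max hc (M := reForm c p)
        (fun v hv => hmax _ (subset_convexHull ℝ _ ⟨⟨v, mem_sphere_zero_iff_norm.2 hv⟩, rfl⟩))
        (Finset.univ.map ⟨_, hyinj⟩) (by
          simp only [Finset.mem_map, Finset.mem_univ, true_and, Function.Embedding.coeFn_mk]
          rintro _ ⟨i, rfl⟩
          exact ⟨mem_sphere_zero_iff_norm.1 (y i).2, (congrArg _ (hy i)).trans (heq i)⟩)
      simpa using h1
    obtain ⟨t, ht, x, hx⟩ := exists_fin_sum_eq (k := k) hcard (w := w) ⟨fun i => (hw i).le, hw1⟩ y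
    exact ⟨t, ht, x, hx.trans ((Finset.sum_congr rfl fun i _ => by rw [← hy i]).trans hsum)⟩
  · rintro ⟨t, ht, x, rfl⟩
    obtain ⟨c, M, hc, hM⟩ := exists_reForm_max_iff hk x
    refine ⟨subset_closure (sum_smul_mem_momentBody ht x),
      notMem_interior_of_reForm_eq_max hc (fun z => (hM z).1) ?_⟩
    have h1 : ∀ i, reForm c (momentCurve k (x i)) = M := fun i => (hM (x i)).2.2 ⟨i, rfl⟩
    simp [map_sum, h1, ← Finset.sum_mul, ht.2]

/-! ### Barycenters and injectivity of the moment map -/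

/-- The barycenter `∑ tᵢ δ_{xᵢ}`. -/
def Barycenter.ofData {k : ℕ} (t : stdSimplex ℝ (Fin k)) (x : Fin k → S1) : Barycenter k :=
  ⟨∑ i, ENNReal.ofReal (t.1 i) • Measure.dirac (x i), t.1, t.2, x, rfl⟩

theorem Barycenter.exists_ofData {k : ℕ} (σ : Barycenter k) :
    ∃ (t : stdSimplex ℝ (Fin k)) (x : Fin k → S1), σ = ofData t x := by
  obtain ⟨μ, t, ht, x, rfl⟩ := σ
  exact ⟨⟨t, ht⟩, x, rfl⟩

theorem Barycenter.integral_ofData {k : ℕ} {E : Type*} [NormedAddCommGroup E] [NormedSpace ℝ E]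
    [CompleteSpace E] (t : stdSimplex ℝ (Fin k)) (x : Fin k → S1) (f : S1 → E) :
    ∫ z, f z ∂(ofData t x).toMeasure = ∑ i, t.1 i • f (x i) := by
  change ∫ z, f z ∂(∑ i, ENNReal.ofReal (t.1 i) • Measure.dirac (x i)) = _
  rw [integral_finsetSum_measure fun i _ =>
    (integrable_dirac (by finiteness)).smul_measure ENNReal.ofReal_ne_top]
  refine Finset.sum_congr rfl fun i _ => ?_
  rw [integral_smul_measure, integral_dirac, ENNReal.toReal_ofReal (t.2.1 i)]

theorem momentMap_ofData {k : ℕ} (t : stdSimplex ℝ (Fin k)) (x : Fin k → S1) :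
    momentMap k (Barycenter.ofData t x) = ∑ i, t.1 i • momentCurve k (x i) := by
  ext l
  simp [momentMap, Barycenter.integral_ofData, momentCurve]

/-- A barycenter with the same moments as `∑ tᵢ δ_{xᵢ}` is carried by the points `xᵢ`: it gives
mean zero to the nonnegative trigonometric polynomial of degree `k` vanishing just there. -/
theorem mem_range_of_sum_momentCurve_eq {k : ℕ} (hk : 1 ≤ k) {t s : stdSimplex ℝ (Fin k)}
    {x y : Fin k → S1}
    (h : ∑ i, t.1 i • momentCurve k (x i) = ∑ i, s.1 i • momentCurve k (y i)) (i : Fin k)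
    (hi : s.1 i ≠ 0) : y i ∈ Set.range x := by
  obtain ⟨c, M, -, hM⟩ := exists_reForm_max_iff hk x
  have hx : ∀ i, reForm c (momentCurve k (x i)) = M := fun i => (hM (x i)).2.2 ⟨i, rfl⟩
  have h1 := congrArg (reForm c) h
  simp only [map_sum, map_smul, hx, smul_eq_mul] at h1
  rw [← Finset.sum_mul, t.2.2, one_mul] at h1
  have hzero : ∑ i, s.1 i * (M - reForm c (momentCurve k (y i))) = 0 := by
    simp only [mul_sub, Finset.sum_sub_distrib]
    rw [← Finset.sum_mul, s.2.2, one_mul, ← h1, sub_self]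
  have h2 := (Finset.sum_eq_zero_iff_of_nonneg fun i _ =>
    mul_nonneg (s.2.1 i) (sub_nonneg.2 (hM (y i)).1)).1 hzero i (Finset.mem_univ i)
  exact (hM (y i)).2.1 (sub_eq_zero.1 ((mul_eq_zero.1 h2).resolve_left hi)).symm

theorem sum_mul_eval_eq_of_sum_momentCurve_eq {k : ℕ} {t s : stdSimplex ℝ (Fin k)}
    {x y : Fin k → S1}
    (h : ∑ i, t.1 i • momentCurve k (x i) = ∑ i, s.1 i • momentCurve k (y i)) {q : ℂ[X]}
    (hq : q.natDegree < k + 1) :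
    ∑ i, (t.1 i : ℂ) * q.eval (x i : ℂ) = ∑ i, (s.1 i : ℂ) * q.eval (y i : ℂ) := by
  have hpow : ∀ m ∈ Finset.range (k + 1),
      ∑ i, (t.1 i : ℂ) * (x i : ℂ) ^ m = ∑ i, (s.1 i : ℂ) * (y i : ℂ) ^ m := by
    rintro (_ | m) hm
    · have h1 := congrArg ((↑) : ℝ → ℂ) (t.2.2.trans s.2.2.symm)
      simpa using h1
    · have hm' : m < k := by simpa using hm
      have h1 := congrArg (fun v : EuclideanSpace ℂ (Fin k) => v ⟨m, hm'⟩) h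
      simpa [momentCurve] using h1
  simp only [eval_eq_sum_range' hq, Finset.mul_sum]
  rw [Finset.sum_comm, Finset.sum_comm (s := Finset.univ)]
  refine Finset.sum_congr rfl fun m hm => ?_
  have h1 := congrArg (q.coeff m * ·) (hpow m hm)
  simp only [Finset.mul_sum] at h1
  refine Eq.trans ?_ (h1.trans ?_) <;> exact Finset.sum_congr rfl fun i _ => by ring

/-- Both barycenters are carried by the same `k` points, where every function agrees with a
polynomial of degree less than `k`. -/
theorem momentMap_injective {k : ℕ} (hk : 1 ≤ k) : Function.Injective (momentMap k) := by
  intro σ τ h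
  obtain ⟨t, x, rfl⟩ := σ.exists_ofData
  obtain ⟨s, y, rfl⟩ := τ.exists_ofData
  rw [momentMap_ofData, momentMap_ofData] at h
  have key : ∀ f : S1 → ℝ, ∑ i, t.1 i • f (x i) = ∑ i, s.1 i • f (y i) := by
    classical
    intro f
    let Z : Finset S1 := Finset.univ.image x
    have hZ : Set.InjOn (fun z : S1 => (z : ℂ)) Z := Subtype.val_injective.injOn
    let q : ℂ[X] := Lagrange.interpolate Z (fun z : S1 => (z : ℂ)) fun z => (f z : ℂ)
    have hZcard : Z.card ≤ k := Finset.card_image_le.trans (by simp)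
    have hqdeg : q.natDegree < k + 1 := by
      have h1 := (Lagrange.degree_interpolate_lt (fun z => (f z : ℂ)) hZ).le
      exact Nat.lt_succ_of_le ((natDegree_le_of_degree_le h1).trans hZcard)
    have hqeval : ∀ z ∈ Z, q.eval (z : ℂ) = f z := fun z hz =>
      Lagrange.eval_interpolate_at_node (fun z => (f z : ℂ)) hZ hz
    have h1 := sum_mul_eval_eq_of_sum_momentCurve_eq h hqdeg
    have hleft : ∀ i, (t.1 i : ℂ) * q.eval (x i : ℂ) = ((t.1 i * f (x i) : ℝ) : ℂ) := fun i => by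
      rw [hqeval _ (Finset.mem_image_of_mem x (Finset.mem_univ i)), Complex.ofReal_mul]
    have hright : ∀ i, (s.1 i : ℂ) * q.eval (y i : ℂ) = ((s.1 i * f (y i) : ℝ) : ℂ) := fun i => by
      by_cases hi : s.1 i = 0
      · simp [hi]
      · obtain ⟨j, hj⟩ := mem_range_of_sum_momentCurve_eq hk h i hi
        rw [hqeval _ (hj ▸ Finset.mem_image_of_mem x (Finset.mem_univ j)), Complex.ofReal_mul]
    simp only [hleft, hright] at h1
    exact_mod_cast h1
  refine eq_of_dist_eq_zero ?_
  change krDist _ _ = 0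
  simp only [krDist, Barycenter.integral_ofData, key, sub_self, abs_zero, ciSup_const]

/-! ### Topology of the space of barycenters -/

theorem dist_eq_krDist {k : ℕ} (σ τ : Barycenter k) :
    dist σ τ = krDist σ.toMeasure τ.toMeasure := rfl

/-- The barycenter map is continuous: moving a weight or a point by `ε` changes the integral of a
`1`-Lipschitz function, which may be normalized to be bounded by `2`, by at most `2 ε`. -/
theorem continuous_ofData (k : ℕ) :
    Continuous fun q : stdSimplex ℝ (Fin k) × (Fin k → S1) => Barycenter.ofData q.1 q.2 := by
  have hbound : ∀ q r : stdSimplex ℝ (Fin k) × (Fin k → S1),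
      dist (Barycenter.ofData q.1 q.2) (Barycenter.ofData r.1 r.2)
        ≤ ∑ i, (|q.1.1 i - r.1.1 i| * 2 + r.1.1 i * dist (q.2 i) (r.2 i)) := by
    rintro ⟨t, x⟩ ⟨s, y⟩
    refine ciSup_le fun ⟨f, hf⟩ => ?_
    let p : S1 := rootPoint 1 0
    have h1 : ∀ (t : stdSimplex ℝ (Fin k)) (x : Fin k → S1),
        ∑ i, t.1 i • f (x i) = ∑ i, t.1 i * (f (x i) - f p) + f p := by
      intro t x
      simp only [mul_sub, Finset.sum_sub_distrib, smul_eq_mul]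
      rw [← Finset.sum_mul, t.2.2]
      ring
    simp only [Barycenter.integral_ofData, h1]
    rw [add_sub_add_right_eq_sub, ← Finset.sum_sub_distrib]
    refine (Finset.abs_sum_le_sum_abs _ _).trans (Finset.sum_le_sum fun i _ => ?_)
    have h2 : t.1 i * (f (x i) - f p) - s.1 i * (f (y i) - f p)
        = (t.1 i - s.1 i) * (f (x i) - f p) + s.1 i * (f (x i) - f (y i)) := by ring
    rw [h2]
    refine (abs_add_le _ _).trans (add_le_add ?_ ?_)
    · rw [abs_mul]
      have h3 : |f (x i) - f p| ≤ 2 := by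
        simpa using abs_integral_sub_le (Measure.dirac (x i)) hf p
      exact mul_le_mul_of_nonneg_left h3 (abs_nonneg _)
    · rw [abs_mul, abs_of_nonneg (s.2.1 i)]
      have h3 := hf.dist_le_mul (x i) (y i)
      rw [Real.dist_eq, NNReal.coe_one, one_mul] at h3
      exact mul_le_mul_of_nonneg_left h3 (s.2.1 i)
  rw [continuous_iff_continuousAt]
  intro r
  rw [ContinuousAt, tendsto_iff_dist_tendsto_zero]
  refine squeeze_zero (fun _ => dist_nonneg) (fun q => hbound q r) ?_
  have hw : ∀ i, Continuous fun q : stdSimplex ℝ (Fin k) × (Fin k → S1) => q.1.1 i :=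
    fun i => (continuous_apply i).comp (continuous_subtype_val.comp continuous_fst)
  have hx : ∀ i, Continuous fun q : stdSimplex ℝ (Fin k) × (Fin k → S1) => q.2 i :=
    fun i => (continuous_apply i).comp continuous_snd
  have hcont : Continuous fun q : stdSimplex ℝ (Fin k) × (Fin k → S1) =>
      ∑ i, (|q.1.1 i - r.1.1 i| * 2 + r.1.1 i * dist (q.2 i) (r.2 i)) :=
    continuous_finsetSum _ fun i _ => ((((hw i).sub continuous_const).abs).mul
      continuous_const).add (continuous_const.mul ((hx i).dist continuous_const))
  simpa using hcont.tendsto r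

instance (k : ℕ) : CompactSpace (Barycenter k) := by
  have : CompactSpace (stdSimplex ℝ (Fin k)) :=
    isCompact_iff_compactSpace.1 (isCompact_stdSimplex ℝ (Fin k))
  refine Function.Surjective.compactSpace (continuous_ofData k) (fun σ => ?_)
  obtain ⟨t, x, rfl⟩ := σ.exists_ofData
  exact ⟨(t, x), rfl⟩

theorem lipschitzWith_integral {k : ℕ} {C : ℝ≥0} {f : S1 → ℝ} (hf : LipschitzWith C f) :
    LipschitzWith (C + 1) fun σ : Barycenter k => ∫ z, f z ∂σ.toMeasure := by
  refine LipschitzWith.of_dist_le_mul fun σ τ => ?_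
  have hpos : (0 : ℝ) < (C : ℝ) + 1 := by positivity
  -- Dividing by `C + 1` rather than by `C`, which may vanish.
  have hg : LipschitzWith 1 fun x => ((C : ℝ) + 1)⁻¹ * f x := by
    refine LipschitzWith.of_dist_le_mul fun x y => ?_
    have h1 := hf.dist_le_mul x y
    rw [Real.dist_eq] at h1 ⊢
    rw [← mul_sub, abs_mul, abs_of_pos (inv_pos.2 hpos), inv_mul_le_iff₀ hpos, NNReal.coe_one,
      one_mul, add_mul]
    linarith [dist_nonneg (x := x) (y := y)]
  have h3 := le_krDist σ.toMeasure τ.toMeasure hg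
  rw [integral_const_mul, integral_const_mul, ← mul_sub, abs_mul, abs_of_pos (inv_pos.2 hpos),
    inv_mul_le_iff₀ hpos] at h3
  simpa [Real.dist_eq, dist_eq_krDist] using h3

theorem continuous_momentMap (k : ℕ) : Continuous (momentMap k) := by
  refine (PiLp.continuous_toLp 2 _).comp (continuous_pi fun j => ?_)
  have hint : ∀ σ : Barycenter k, Integrable (fun z : S1 => (z : ℂ) ^ ((j : ℕ) + 1)) σ.toMeasure :=
    fun σ => Continuous.integrable_of_hasCompactSupport (by fun_prop)
      (HasCompactSupport.of_compactSpace _)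
  obtain ⟨C, hC⟩ : ∃ C : ℝ≥0, LipschitzWith C fun z : S1 => (z : ℂ) ^ ((j : ℕ) + 1) := by
    refine ⟨(j : ℕ) + 1, LipschitzWith.of_dist_le_mul fun z w => ?_⟩
    have hz : ∀ z : S1, ‖(z : ℂ)‖ = 1 := fun z => mem_sphere_zero_iff_norm.1 z.2
    rw [dist_eq_norm, ← (Commute.all (z : ℂ) w).geom_sum₂_mul, norm_mul, Subtype.dist_eq,
      dist_eq_norm]
    refine mul_le_mul_of_nonneg_right ((norm_sum_le _ _).trans ?_) (norm_nonneg _)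
    simp [hz]
  have hre := (lipschitzWith_integral (k := k)
    (Complex.reCLM.lipschitz.comp hC)).continuous
  have him := (lipschitzWith_integral (k := k)
    (Complex.imCLM.lipschitz.comp hC)).continuous
  have heq : (fun σ : Barycenter k => ∫ z : S1, (z : ℂ) ^ ((j : ℕ) + 1) ∂σ.toMeasure)
      = fun σ => ((∫ z : S1, ((z : ℂ) ^ ((j : ℕ) + 1)).re ∂σ.toMeasure : ℝ) : ℂ)
        + ((∫ z : S1, ((z : ℂ) ^ ((j : ℕ) + 1)).im ∂σ.toMeasure : ℝ) : ℂ) * Complex.I := by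
    funext σ
    exact (integral_re_add_im (hint σ)).symm
  rw [heq]
  exact (Complex.continuous_ofReal.comp hre).add
    ((Complex.continuous_ofReal.comp him).mul continuous_const)

/-! ### The boundary sphere -/

theorem range_momentMap {k : ℕ} (hk : 1 ≤ k) :
    Set.range (momentMap k) = frontier (momentBody k) := by
  ext p
  rw [mem_frontier_momentBody_iff hk]
  constructor
  · rintro ⟨σ, rfl⟩
    obtain ⟨t, x, rfl⟩ := σ.exists_ofData
    exact ⟨t.1, t.2, x, (momentMap_ofData t x).symm⟩
  · rintro ⟨t, ht, x, rfl⟩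
    exact ⟨_, momentMap_ofData ⟨t, ht⟩ x⟩

/-- The boundary of a bounded convex set with nonempty interior in a real vector space of
dimension `n` is homeomorphic to the unit sphere of `ℝⁿ`. -/
theorem nonempty_homeomorph_frontier_sphere {E : Type*} [NormedAddCommGroup E] [NormedSpace ℝ E]
    [FiniteDimensional ℝ E] {n : ℕ} (hn : Module.finrank ℝ E = n) {K : Set E} (hc : Convex ℝ K)
    (hne : (interior K).Nonempty) (hb : Bornology.IsBounded K) :
    Nonempty (frontier K ≃ₜ Metric.sphere (0 : EuclideanSpace ℝ (Fin n)) 1) := by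
  obtain ⟨L⟩ : Nonempty (E ≃L[ℝ] EuclideanSpace ℝ (Fin n)) :=
    FiniteDimensional.nonempty_continuousLinearEquiv_of_finrank_eq (by simp [hn])
  have hint : interior (L '' K) = L '' interior K := (L.toHomeomorph.image_interior K).symm
  obtain ⟨h, -, -, hh⟩ := exists_homeomorph_image_interior_closure_frontier_eq_unitBall
    (hc.linear_image (L : E →ₗ[ℝ] EuclideanSpace ℝ (Fin n))) (hint ▸ hne.image L)
    (L.lipschitz.isBounded_image hb)
  have hfr : frontier (L '' K) = L '' frontier K := (L.toHomeomorph.image_frontier K).symm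
  rw [← hh]
  exact ⟨(L.toHomeomorph.image (frontier K)).trans
    ((Homeomorph.setCongr hfr.symm).trans (h.image (frontier (L '' K))))⟩

end BaryCircle

end

theorem proposition3p2 (k : ℕ) (hk : 1 ≤ k) :
    ∃ S U : Set (EuclideanSpace ℂ (Fin k)),
      -- the moment map is a homeomorphism of `(S¹)_k` onto `S`
      (∃ e : BaryCircle.Barycenter k ≃ₜ S,
        ∀ σ : BaryCircle.Barycenter k,
          (e σ : EuclideanSpace ℂ (Fin k)) = BaryCircle.momentMap k σ) ∧
      -- `S` is a topological sphere of dimension `2k - 1`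
      Nonempty (S ≃ₜ Metric.sphere (0 : EuclideanSpace ℝ (Fin (2 * k))) 1) ∧
      -- `S` bounds the bounded domain `U`, a neighborhood of `0`
      IsOpen U ∧ IsConnected U ∧ Bornology.IsBounded U ∧
      (0 : EuclideanSpace ℂ (Fin k)) ∈ U ∧ frontier U = S := by
  have hconv := BaryCircle.convex_momentBody k
  have hcomp := BaryCircle.isCompact_momentBody k
  have h0 := BaryCircle.zero_mem_interior_momentBody k
  have hrange := BaryCircle.range_momentMap hk
  have hemb := (BaryCircle.continuous_momentMap k).isClosedEmbedding
    (BaryCircle.momentMap_injective hk)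
  refine ⟨Set.range (BaryCircle.momentMap k), interior (BaryCircle.momentBody k),
    ⟨hemb.isEmbedding.toHomeomorph, fun σ => rfl⟩, ?_, isOpen_interior,
    ⟨⟨0, h0⟩, hconv.interior.isPreconnected⟩, hcomp.isBounded.subset interior_subset, h0, ?_⟩
  · rw [hrange]
    refine BaryCircle.nonempty_homeomorph_frontier_sphere ?_ hconv ⟨0, h0⟩ hcomp.isBounded
    rw [← Module.finrank_mul_finrank ℝ ℂ, Complex.finrank_real_complex, finrank_euclideanSpace_fin]
  · rw [hrange, frontier, interior_interior,
      hconv.closure_interior_eq_closure_of_nonempty_interior ⟨0, h0⟩, frontier]
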